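/- Let $\mathcal G=(V,D,B)$ be a mixed graph on a finite vertex set $V$: $D\subseteq V\times V$ is a set of directed edges $i\to j$ without self-loops (directed cycles are allowed), and $B$ is a set of two-element subsets of $V$, the bidirected edges. Let $\mathbb R^D_{\rm reg}$ be the set of real $V\times V$ matrices $\Lambda=(\lambda_{ij})$ with $\lambda_{ij}=0$ whenever $i\to j\notin D$ and with $I-\Lambda$ invertible, and let $\mathit{PD}(B)$ be the set of positive definite $V\times V$ matrices $\Omega=(\omega_{ij})$ with $\omega_{ij}=0$ whenever $i\ne j$ and $\{i,j\}\notin B$. The covariance matrices of the linear structural equation model given by $\mathcal G$ are $$\mathit{PD}(\mathcal G)=\{(I-\Lambda)^{-T}\Omega(I-\Lambda)^{-1} : \Lambda\in\mathbb R^D_{\rm reg},\ \Omega\in\mathit{PD}(B)\}.$$ For a sample $X^{(1)},\dots,X^{(n)}\in\mathbb R^V$ let $S_{0,n}=\frac1n\sum_{s=1}^n X^{(s)}(X^{(s)})^T$ (with $S_{0,0}=0$), and let $$\hat\ell(\mathcal G\,|\,S)=\sup\{-\log\det\Sigma-\operatorname{trace}(\Sigma^{-1}S) : \Sigma\in\mathit{PD}(\mathcal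 G)\}\in(-\infty,\infty].$$ Let "almost surely" refer to an independent sample $X^{(1)},\dots,X^{(n)}$ from a fixed regular multivariate normal distribution or, more generally, from any fixed absolutely continuous probability distribution on $\mathbb R^V$. The zero-mean maximum likelihood threshold is $$\operatorname{mlt}_0(\mathcal G)=\min\{N\in\mathbb N : \hat\ell(\mathcal G\,|\,S_{0,n})<\infty\ \text{almost surely for all } n\ge N\}.$$ For $A\subseteq V$ let $\operatorname{Pa}(A)=A\cup\{k\in V : k\to i\in D\text{ for some }i\in A\}$. **Theorem.** Let $C_1,\dots,C_l$ be the vertex sets of the connected components of the bidirected part $(V,\emptyset,B)$ of $\mathcal G$. Then the minimum defining $\operatorname{mlt}_0(\mathcal G)$ exists, and $$\operatorname{mlt}_0(\mathcal G)=\max_{j=1,\dots,l}|\operatorname{Pa}(C_j)|$$ (where the maximum is read as $0$ if $V=\emptyset$), for each such distribution. Moreover, if $n<\operatorname{mlt}_0(\mathcal G)$, then $\hat\ell(\mathcal G\,|\,S_{0,n})=\infty$ almost surely. -/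

import Mathlib

open MeasureTheory
open scoped Matrix

/-- A mixed graph `(V, D, B)`: directed edges `i → j` (`Dir i j`), without self-loops, and
bidirected edges, i.e. a set of 2-element subsets of `V`, which is a simple graph. Directed cycles
are allowed, and two nodes may be joined by several edges of different kinds. -/
structure MixedGraph (V : Type*) where
  /-- `Dir i j` means `i → j`. -/
  Dir : V → V → Prop
  dir_irrefl : ∀ i, ¬ Dir i i
  /-- The bidirected part. -/
  Bi : SimpleGraph V

namespace MixedGraph

variable {V : Type*}

/-- The parents of the node `j`. -/
def pa (G : MixedGraph V) (j : V) : Set V := {k | G.Dir k j}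

/-- `Pa(A)`: the set `A` together with the parents of its elements. -/
def Pa (G : MixedGraph V) (A : Set V) : Set V := A ∪ ⋃ i ∈ A, G.pa i

variable [Fintype V] [DecidableEq V]

/-- The matrices `Λ` supported on the directed edges such that `I - Λ` is invertible. -/
def coeffMatrices (G : MixedGraph V) : Set (Matrix V V ℝ) :=
  {L | (∀ i j, ¬ G.Dir i j → L i j = 0) ∧ IsUnit (1 - L)}

/-- The positive definite matrices `Ω` whose off-diagonal entries are supported on the bidirected
edges. -/
def errorCovariances (G : MixedGraph V) : Set (Matrix V V ℝ) :=
  {W | W.PosDef ∧ ∀ i j, i ≠ j → ¬ G.Bi.Adj i j → W i j = 0}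

/-- The covariance matrices `(I - Λ)⁻ᵀ Ω (I - Λ)⁻¹` of the linear structural equation model given
by the mixed graph. -/
def PD (G : MixedGraph V) : Set (Matrix V V ℝ) :=
  {A | ∃ L ∈ G.coeffMatrices, ∃ W ∈ G.errorCovariances, A = ((1 - L)⁻¹)ᵀ * W * (1 - L)⁻¹}

/-- The Gaussian (profile) log-likelihood
`ℓ(A | S) = - log det A - trace (A⁻¹ S)` at the covariance matrix `A`. -/
noncomputable def logLik (A S : Matrix V V ℝ) : ℝ :=
  - Real.log A.det - (A⁻¹ * S).trace

/-- The supremum, in the extended reals, of the log-likelihood over the model. -/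
noncomputable def supLogLik (G : MixedGraph V) (S : Matrix V V ℝ) : EReal :=
  ⨆ A ∈ G.PD, ((logLik A S : ℝ) : EReal)

/-- The sample covariance matrix for known mean zero, `(1/n) ∑ X⁽ˢ⁾ (X⁽ˢ⁾)ᵀ`. (For `n = 0` this is
the zero matrix.) -/
noncomputable def sampleCov {n : ℕ} (X : Fin n → V → ℝ) : Matrix V V ℝ :=
  (n : ℝ)⁻¹ • ∑ s, Matrix.vecMulVec (X s) (X s)

/-- The numbers `N` such that, for every `n ≥ N`, the zero-mean log-likelihood function of an
independent sample `X⁽¹⁾, …, X⁽ⁿ⁾` from the distribution `P` is almost surely bounded above on the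
model. The joint law of the sample is the `n`-fold product of `P`. -/
def boundedSampleSizes (G : MixedGraph V) (P : Measure (V → ℝ)) : Set ℕ :=
  {N | ∀ n ≥ N, ∀ᵐ X ∂(Measure.pi fun _ : Fin n => P), G.supLogLik (sampleCov X) < ⊤}

/-- The zero-mean maximum likelihood threshold, for data from `P`: the least element of
`boundedSampleSizes`. -/
noncomputable def mlThreshold (G : MixedGraph V) (P : Measure (V → ℝ)) : ℕ :=
  sInf (G.boundedSampleSizes P)

end MixedGraph

/-!
The threshold is `N = max_C |Pa(C)|`, over the connected components `C` of the bidirected part: the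
supremum of the log-likelihood is almost surely finite at every sample size `n ≥ N`, and almost
surely infinite at every `n < N`. Both halves combine a deterministic statement about the data with
a genericity statement. Write `P = I - Λ` and `A = P⁻ᵀ Ω P⁻¹`, so that `A⁻¹ = P Ω⁻¹ Pᵀ`.

*Finiteness.* For `n ≥ |Pa(C)|` the data vectors restricted to `Pa(C)` almost surely span `ℝ^Pa(C)`
(`ae_span_eq_top_of_absolutelyContinuous`), so for some `ε > 0` the form `y ↦ yᵀ S y` dominates
`ε ‖y‖²` on the vectors supported on any of the sets `Pa(C)`. The columns of `P` indexed by `C` are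
supported on `Pa(C)`, hence the diagonal blocks of `Pᵀ (S - ε I) P` over the components are positive
semidefinite; as `Ω⁻¹` is block diagonal over the components, `tr (A⁻¹ (S - ε I)) ≥ 0`. The
log-likelihood is therefore at most `log det A⁻¹ - ε tr A⁻¹`, which is bounded because
`log x - ε x` is (`MixedGraph.logLik_le_of_forall_mul_dotProduct_le`). No factorization of the
likelihood is used, so directed cycles do no harm.

*Divergence.* If `n < |Pa(C)|`, there is almost surely a vector `v`, supported on `Pa(C)` and
nonzero at each of its elements, that is orthogonal to the data
(`MixedGraph.ae_exists_dotProduct_eq_zero`). Let `w` be its restriction to `C`. Sending one edge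
from every `k ∈ Pa(C) \ C` into `C`, with a suitable coefficient, gives a nilpotent `Λ` with
`(I - Λ) w = v`, so that the residuals `Pᵀ X⁽ˢ⁾` are orthogonal to `w`. Rescaling the graph
Laplacian of the connected component `C` gives a positive semidefinite matrix `M`, with the zero
pattern of the model, whose kernel is spanned by `w`. Along `Ω = M + t I`, `t → 0⁺`, the determinant
tends to `0`, while the trace term stays bounded because the residuals lie in the range of `M`
(`MixedGraph.supLogLik_sampleCov_eq_top`).
-/

/-! ### General position of independent samples -/

section Genericity

variable {E F : Type*} [NormedAddCommGroup E] [NormedSpace ℝ E] [FiniteDimensional ℝ E]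
  [MeasurableSpace E] [BorelSpace E] [NormedAddCommGroup F] [NormedSpace ℝ F]

/-- The pullback of a proper subspace under a surjection is a proper subspace, hence a null set. -/
theorem ae_apply_notMem_of_absolutelyContinuous {ν : Measure E} [ν.IsAddHaarMeasure]
    {P : Measure E} (hP : P ≪ ν) {f : E →ₗ[ℝ] F} (hf : Function.Surjective f)
    {W : Submodule ℝ F} (hW : W ≠ ⊤) : ∀ᵐ x ∂P, f x ∉ W := by
  have h : W.comap f ≠ ⊤ := by
    intro h
    apply hW
    rw [← Submodule.map_comap_eq_of_surjective hf W, h, Submodule.map_top,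
      LinearMap.range_eq_top.2 hf]
  have h0 := hP (Measure.addHaar_submodule ν (W.comap f) h)
  rw [ae_iff]
  simpa [Set.preimage] using h0

/-- An independent sample from an absolutely continuous distribution is in general position: its image
under a linear surjection onto `F` is almost surely linearly independent, as long as the sample size
is at most `dim F`. -/
theorem ae_linearIndependent_of_absolutelyContinuous {ν : Measure E} [ν.IsAddHaarMeasure]
    {P : Measure E} [IsProbabilityMeasure P] (hP : P ≪ ν) {f : E →ₗ[ℝ] F}
    (hf : Function.Surjective f) {n : ℕ} (hn : n ≤ Module.finrank ℝ F) :
    ∀ᵐ X ∂(Measure.pi fun _ : Fin n => P), LinearIndependent ℝ (fun s => f (X s)) := by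
  induction n with
  | zero => exact .of_forall fun X => linearIndependent_empty_type
  | succ n ih =>
    have hf' : Continuous f := f.continuous_of_finiteDimensional
    have hmp := measurePreserving_piFinSuccAbove (fun _ : Fin (n + 1) => P) 0
    have hae : ∀ᵐ z ∂(P.prod (Measure.pi fun _ : Fin n => P)),
        LinearIndependent ℝ (Fin.cons (f z.1) (fun s => f (z.2 s)) : Fin (n + 1) → F) := by
      have hopen : IsOpen {z : E × (Fin n → E) |
          LinearIndependent ℝ (Fin.cons (f z.1) (fun s => f (z.2 s)) : Fin (n + 1) → F)} := by
        refine isOpen_setOfPred_linearIndependent.preimage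
          (f := fun z : E × (Fin n → E) =>
            (Fin.cons (f z.1) (fun s => f (z.2 s)) : Fin (n + 1) → F)) ?_
        refine continuous_pi fun i => ?_
        refine Fin.cases ?_ (fun i => ?_) i
        · simpa [Function.comp_def] using hf'.comp continuous_fst
        · simpa [Function.comp_def] using hf'.comp ((continuous_apply i).comp continuous_snd)
      have hmeas := hopen.measurableSet
      -- Fubini, with the last `n` vectors fixed first: their span is a proper subspace, which the
      -- remaining vector almost surely avoids.
      rw [← Measure.prod_swap, ae_map_iff measurable_swap.aemeasurable hmeas]
      refine (Measure.ae_prod_iff_ae_ae (measurable_swap hmeas)).2 ?_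
      filter_upwards [ih (by omega)] with xs hxs
      have hW : Submodule.span ℝ (Set.range fun s => f (xs s)) ≠ ⊤ := by
        intro h
        have := finrank_range_le_card (R := ℝ) (fun s => f (xs s))
        rw [Set.finrank, h, finrank_top, Fintype.card_fin] at this
        omega
      filter_upwards [ae_apply_notMem_of_absolutelyContinuous hP hf hW] with x hx
      exact linearIndependent_finCons.2 ⟨hxs, hx⟩
    filter_upwards [hmp.quasiMeasurePreserving.ae hae] with X hX
    convert hX using 1
    ext s
    refine Fin.cases ?_ (fun i => ?_) s <;> simp [MeasurableEquiv.piFinSuccAbove, Fin.tail]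

variable [FiniteDimensional ℝ F]

theorem ae_span_eq_top_of_absolutelyContinuous {ν : Measure E} [ν.IsAddHaarMeasure]
    {P : Measure E} [IsProbabilityMeasure P] (hP : P ≪ ν) {f : E →ₗ[ℝ] F}
    (hf : Function.Surjective f) {n : ℕ} (hn : Module.finrank ℝ F ≤ n) :
    ∀ᵐ X ∂(Measure.pi fun _ : Fin n => P),
      Submodule.span ℝ (Set.range fun s => f (X s)) = ⊤ := by
  induction n, hn using Nat.le_induction with
  | base =>
    filter_upwards [ae_linearIndependent_of_absolutelyContinuous hP hf le_rfl] with X hX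
    exact hX.span_eq_top_of_card_eq_finrank' (by simp)
  | succ n hn ih =>
    have hmp := measurePreserving_piFinSuccAbove (fun _ : Fin (n + 1) => P) 0
    have h := hmp.quasiMeasurePreserving.ae (Measure.quasiMeasurePreserving_snd.ae ih)
    filter_upwards [h] with X hX
    rw [eq_top_iff, ← hX]
    refine Submodule.span_mono ?_
    rintro _ ⟨s, rfl⟩
    exact ⟨s.succ, by simp [MeasurableEquiv.piFinSuccAbove, Fin.tail]⟩

end Genericity

/-! ### Positive semidefinite matrices -/

section Matrices

variable {V : Type*} [Fintype V]

/-- If the linear forms `X s ⬝ᵥ ·` have no common zero on the subspace `p` but `0`, then the sum of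
their squares is coercive on `p`. -/
theorem exists_pos_mul_dotProduct_self_le {n : ℕ} (X : Fin n → V → ℝ) (p : Submodule ℝ (V → ℝ))
    (hp : ∀ y ∈ p, (∀ s, X s ⬝ᵥ y = 0) → y = 0) :
    ∃ ε > 0, ∀ y ∈ p, ε * (y ⬝ᵥ y) ≤ ∑ s, (X s ⬝ᵥ y) ^ 2 := by
  set f : p →ₗ[ℝ] (Fin n → ℝ) := (Matrix.of X).mulVecLin.domRestrict p with hf
  have hfa : ∀ (y : p) s, f y s = X s ⬝ᵥ (y : V → ℝ) := fun y s => rfl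
  have hker : LinearMap.ker f = ⊥ := by
    rw [LinearMap.ker_eq_bot']
    intro y hy
    exact Subtype.ext (hp y y.2 fun s => by rw [← hfa, hy]; rfl)
  obtain ⟨K, hK, hfK⟩ := f.exists_antilipschitzWith hker
  have hK' : (0 : ℝ) < K := hK
  refine ⟨((Fintype.card V + 1) * (K : ℝ) ^ 2)⁻¹, by positivity, fun y hy => ?_⟩
  rw [inv_mul_le_iff₀ (by positivity)]
  set T := ∑ s, (X s ⬝ᵥ y) ^ 2 with hT
  have hT0 : 0 ≤ T := Finset.sum_nonneg fun s _ => sq_nonneg _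
  have h1 : ‖f ⟨y, hy⟩‖ ≤ Real.sqrt T := by
    rw [pi_norm_le_iff_of_nonneg (Real.sqrt_nonneg _)]
    intro s
    rw [hfa, Real.norm_eq_abs]
    apply Real.abs_le_sqrt
    exact Finset.single_le_sum (f := fun s => (X s ⬝ᵥ y) ^ 2) (fun s _ => sq_nonneg _)
      (Finset.mem_univ s)
  have h2 : ‖y‖ ≤ K * ‖f ⟨y, hy⟩‖ := by
    have := hfK.le_mul_dist ⟨y, hy⟩ 0
    simpa using this
  have h3 : ‖y‖ ^ 2 ≤ K ^ 2 * T := by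
    calc ‖y‖ ^ 2 ≤ (K * Real.sqrt T) ^ 2 := by
          have := h2.trans (mul_le_mul_of_nonneg_left h1 hK'.le)
          gcongr
      _ = K ^ 2 * T := by rw [mul_pow, Real.sq_sqrt hT0]
  have h4 : y ⬝ᵥ y ≤ Fintype.card V * ‖y‖ ^ 2 := by
    refine (Finset.sum_le_card_nsmul _ _ (‖y‖ ^ 2) fun i _ => ?_).trans_eq (by simp)
    rw [← pow_two, ← sq_abs]
    have := norm_le_pi_norm y i
    rw [Real.norm_eq_abs] at this
    gcongr
  have h5 : (0 : ℝ) ≤ Fintype.card V := by positivity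
  nlinarith [mul_le_mul_of_nonneg_left h3 h5, sq_nonneg (K : ℝ), mul_nonneg (sq_nonneg (K : ℝ)) hT0]

variable [DecidableEq V]

open scoped MatrixOrder in
theorem Matrix.PosSemidef.trace_mul_nonneg {K Y : Matrix V V ℝ} (hK : K.PosSemidef)
    (hY : Y.PosSemidef) : 0 ≤ (K * Y).trace := by
  obtain ⟨B, rfl⟩ := CStarAlgebra.nonneg_iff_eq_star_mul_self.1 hK.nonneg
  rw [Matrix.star_eq_conjTranspose, Matrix.mul_assoc, Matrix.trace_mul_comm]
  exact (hY.mul_mul_conjTranspose_same B).trace_nonneg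

/-- If `K` is positive semidefinite and block diagonal for the partition of the indices into the fibres
of `c`, then `tr (K Y)` only sees the diagonal blocks of `Y`, so it suffices that these are positive
semidefinite. -/
theorem trace_mul_nonneg_of_blockwise {ι : Type*} [Fintype ι] [DecidableEq ι] (c : V → ι)
    {K Y : Matrix V V ℝ} (hK : K.PosSemidef) (hKc : ∀ i j, c i ≠ c j → K i j = 0)
    (hY : Y.IsHermitian)
    (hYc : ∀ a (x : V → ℝ), (∀ i, c i ≠ a → x i = 0) → 0 ≤ x ⬝ᵥ (Y *ᵥ x)) :
    0 ≤ (K * Y).trace := by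
  -- `Z` is the block diagonal part of `Y`.
  set Z : Matrix V V ℝ := Matrix.of fun i j => if c i = c j then Y i j else 0 with hZ
  have hKZ : (K * Y).trace = (K * Z).trace := by
    simp only [Matrix.trace, Matrix.diag, Matrix.mul_apply]
    refine Finset.sum_congr rfl fun i _ => Finset.sum_congr rfl fun j _ => ?_
    by_cases h : c i = c j
    · simp [hZ, h]
    · simp [hKc i j h]
  rw [hKZ]
  refine hK.trace_mul_nonneg (.of_dotProduct_mulVec_nonneg ?_ fun x => ?_)
  · ext i j
    have := hY.apply i j
    simp only [star_trivial] at this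
    simp [hZ, this, eq_comm]
  · have key : x ⬝ᵥ (Z *ᵥ x) = ∑ a, (fun i => if c i = a then x i else 0) ⬝ᵥ
        (Y *ᵥ fun i => if c i = a then x i else 0) := by
      simp only [dotProduct, Matrix.mulVec, hZ, Matrix.of_apply]
      rw [Finset.sum_comm]
      refine Finset.sum_congr rfl fun i _ => ?_
      rw [Finset.sum_eq_single (c i)]
      · simp [eq_comm]
      · intro a _ ha
        simp [ha.symm]
      · simp
    rw [star_trivial, key]
    refine Finset.sum_nonneg fun a _ => hYc a _ fun i hi => by simp [hi]

/-- The inverse of a block diagonal matrix is block diagonal: it commutes with the coordinate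
projections onto the blocks. -/
theorem inv_apply_eq_zero_of_blockwise {ι : Type*} (c : V → ι)
    {W : Matrix V V ℝ} (hW : IsUnit W) (hWc : ∀ i j, c i ≠ c j → W i j = 0)
    {i j : V} (hij : c i ≠ c j) : W⁻¹ i j = 0 := by
  classical
  set D : Matrix V V ℝ := Matrix.diagonal fun k => if c k = c i then 1 else 0 with hD
  have hcomm : W * D = D * W := by
    ext k l
    simp only [hD, Matrix.mul_diagonal, Matrix.diagonal_mul]
    by_cases h : c k = c l
    · simp [h]
    · simp [hWc k l h]
  have hdet := (Matrix.isUnit_iff_isUnit_det _).1 hW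
  have hinv : W⁻¹ * D = D * W⁻¹ := by
    calc W⁻¹ * D = W⁻¹ * D * (W * W⁻¹) := by rw [Matrix.mul_nonsing_inv _ hdet, Matrix.mul_one]
      _ = W⁻¹ * (D * W) * W⁻¹ := by simp only [Matrix.mul_assoc]
      _ = (W⁻¹ * W) * D * W⁻¹ := by rw [← hcomm]; simp only [Matrix.mul_assoc]
      _ = D * W⁻¹ := by rw [Matrix.nonsing_inv_mul _ hdet, Matrix.one_mul]
  have h := congrFun (congrFun hinv i) j
  simpa [hD, Matrix.mul_diagonal, Matrix.diagonal_mul, hij.symm] using h.symm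

/-- Apply `log (ε x) ≤ ε x - 1` to each eigenvalue `x` of `K`. -/
theorem Matrix.PosDef.log_det_sub_trace_le {K : Matrix V V ℝ} (hK : K.PosDef) {ε : ℝ}
    (hε : 0 < ε) :
    Real.log K.det - ε * K.trace ≤ Fintype.card V * (-1 - Real.log ε) := by
  have hpos := hK.eigenvalues_pos
  rw [hK.isHermitian.det_eq_prod_eigenvalues, hK.isHermitian.trace_eq_sum_eigenvalues]
  simp only [RCLike.ofReal_real_eq_id, id_eq]
  rw [Real.log_prod fun i _ => (hpos i).ne', Finset.mul_sum, ← Finset.sum_sub_distrib]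
  refine (Finset.sum_le_card_nsmul _ _ (-1 - Real.log ε) fun i _ => ?_).trans_eq (by simp)
  have h := Real.log_le_sub_one_of_pos (mul_pos hε (hpos i))
  rw [Real.log_mul hε.ne' (hpos i).ne'] at h
  linarith

/-- On the range of `M`, the form of `W⁻¹` is bounded by that of a generalized inverse of `M` whenever
`M ≤ W`. The bound does not depend on `W`, which may approach the singular matrix `M`. -/
theorem dotProduct_inv_mulVec_le {M W : Matrix V V ℝ} (hM : M.PosSemidef) (hW : W.PosDef)
    (hMW : ∀ x, x ⬝ᵥ (M *ᵥ x) ≤ x ⬝ᵥ (W *ᵥ x)) (z : V → ℝ) :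
    (M *ᵥ z) ⬝ᵥ (W⁻¹ *ᵥ (M *ᵥ z)) ≤ z ⬝ᵥ (M *ᵥ z) := by
  set x := W⁻¹ *ᵥ (M *ᵥ z) with hx
  have hdet := (Matrix.isUnit_iff_isUnit_det _).1 hW.isUnit
  have hWx : W *ᵥ x = M *ᵥ z := by
    rw [hx, Matrix.mulVec_mulVec, Matrix.mul_nonsing_inv _ hdet, Matrix.one_mulVec]
  have h1 := hMW x
  rw [hWx] at h1
  -- With `x = W⁻¹ M z`, expand `0 ≤ (x - z)ᵀ M (x - z)` and use `xᵀ M x ≤ xᵀ W x = xᵀ M z`.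
  have h2 := hM.dotProduct_mulVec_nonneg (x - z)
  have hsymm : z ⬝ᵥ (M *ᵥ x) = x ⬝ᵥ (M *ᵥ z) := by
    have hT : Mᵀ = M := hM.isHermitian
    rw [Matrix.dotProduct_mulVec, dotProduct_comm, ← Matrix.mulVec_transpose, hT]
  rw [star_trivial, Matrix.mulVec_sub, sub_dotProduct, dotProduct_sub, dotProduct_sub] at h2
  rw [dotProduct_comm]
  linarith

/-- The range of a symmetric matrix with kernel spanned by `w` is the orthogonal complement of `w`. -/
theorem exists_mulVec_eq_of_dotProduct_eq_zero {M : Matrix V V ℝ} (hM : M.PosSemidef)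
    {w : V → ℝ} (hw : w ≠ 0) (hMw : M *ᵥ w = 0)
    (hker : ∀ x, M *ᵥ x = 0 → ∃ a : ℝ, x = a • w) {y : V → ℝ} (hy : w ⬝ᵥ y = 0) :
    ∃ z, M *ᵥ z = y := by
  -- `M + w wᵀ` is invertible, maps `w` to a multiple of `w`, and agrees with `M` on `w^⊥`.
  set N := M + Matrix.vecMulVec w w with hN
  have hww : w ⬝ᵥ w ≠ 0 := by simpa using hw
  have hNx : ∀ x, N *ᵥ x = M *ᵥ x + (w ⬝ᵥ x) • w := fun x => by
    rw [hN, Matrix.add_mulVec, Matrix.vecMulVec_mulVec]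
    simp
  have hwM : ∀ x, w ⬝ᵥ (M *ᵥ x) = 0 := fun x => by
    have hT : Mᵀ = M := hM.isHermitian
    rw [Matrix.dotProduct_mulVec, ← Matrix.mulVec_transpose, hT, hMw, zero_dotProduct]
  have hwN : ∀ x, w ⬝ᵥ (N *ᵥ x) = (w ⬝ᵥ x) * (w ⬝ᵥ w) := fun x => by
    rw [hNx, dotProduct_add, hwM, dotProduct_smul, smul_eq_mul, zero_add]
  have hdet : IsUnit N.det := by
    rw [isUnit_iff_ne_zero]
    intro h0
    obtain ⟨x, hx, hNx0⟩ := Matrix.exists_mulVec_eq_zero_iff.2 h0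
    have h1 := hwN x
    rw [hNx0, dotProduct_zero, eq_comm, mul_eq_zero, or_iff_left hww] at h1
    rw [hNx, h1, zero_smul, add_zero] at hNx0
    obtain ⟨a, rfl⟩ := hker x hNx0
    rw [dotProduct_smul, smul_eq_mul, mul_eq_zero, or_iff_left hww] at h1
    exact hx (by rw [h1, zero_smul])
  refine ⟨N⁻¹ *ᵥ y, ?_⟩
  have hNz : N *ᵥ (N⁻¹ *ᵥ y) = y := by
    rw [Matrix.mulVec_mulVec, Matrix.mul_nonsing_inv _ hdet, Matrix.one_mulVec]
  have h1 := hwN (N⁻¹ *ᵥ y)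
  rw [hNz, hy, eq_comm, mul_eq_zero, or_iff_left hww] at h1
  have h2 := hNx (N⁻¹ *ᵥ y)
  rw [hNz, h1, zero_smul, add_zero] at h2
  exact h2.symm

end Matrices

namespace MixedGraph

/-! ### Bounds on the log-likelihood for given data -/

section Likelihood

theorem isHermitian_sampleCov {V : Type*} {n : ℕ} (X : Fin n → V → ℝ) : (sampleCov X).IsHermitian := by
  ext i j
  simp [sampleCov, Matrix.sum_apply, Matrix.vecMulVec_apply, mul_comm]

variable {V : Type*} [Fintype V]

theorem trace_mul_sampleCov {n : ℕ} (K : Matrix V V ℝ) (X : Fin n → V → ℝ) :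
    (K * sampleCov X).trace = (n : ℝ)⁻¹ * ∑ s, X s ⬝ᵥ (K *ᵥ X s) := by
  rw [sampleCov, Matrix.mul_smul, Matrix.trace_smul, Matrix.mul_sum, Matrix.trace_sum, smul_eq_mul]
  congr 1
  refine Finset.sum_congr rfl fun s _ => ?_
  rw [Matrix.mul_vecMulVec, Matrix.trace_vecMulVec, dotProduct_comm]

theorem dotProduct_sampleCov_mulVec {n : ℕ} (X : Fin n → V → ℝ) (y : V → ℝ) :
    y ⬝ᵥ (sampleCov X *ᵥ y) = (n : ℝ)⁻¹ * ∑ s, (X s ⬝ᵥ y) ^ 2 := by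
  rw [sampleCov, Matrix.smul_mulVec, dotProduct_smul, smul_eq_mul, Matrix.sum_mulVec,
    dotProduct_sum]
  congr 1
  refine Finset.sum_congr rfl fun s _ => ?_
  rw [Matrix.vecMulVec_mulVec, op_smul_eq_smul, dotProduct_smul, smul_eq_mul,
    dotProduct_comm y, pow_two]

variable [DecidableEq V]

theorem inv_transpose_inv_mul_mul_inv {P : Matrix V V ℝ} (hP : IsUnit P) (W : Matrix V V ℝ) :
    ((P⁻¹)ᵀ * W * P⁻¹)⁻¹ = P * W⁻¹ * Pᵀ := by
  have hdet := (Matrix.isUnit_iff_isUnit_det _).1 hP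
  rw [Matrix.mul_inv_rev, Matrix.mul_inv_rev, Matrix.nonsing_inv_nonsing_inv _ hdet,
    ← Matrix.transpose_nonsing_inv, Matrix.nonsing_inv_nonsing_inv _ hdet, Matrix.mul_assoc]

theorem mulVec_eq_zero_of_notMem_Pa {G : MixedGraph V} {L : Matrix V V ℝ}
    (hL : L ∈ G.coeffMatrices) {A : Set V} {x : V → ℝ} (hx : ∀ i, i ∉ A → x i = 0) {k : V}
    (hk : k ∉ G.Pa A) : ((1 - L) *ᵥ x) k = 0 := by
  rw [Pa, Set.mem_union, not_or] at hk
  rw [Matrix.sub_mulVec, Matrix.one_mulVec, Pi.sub_apply, hx k hk.1, zero_sub, neg_eq_zero]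
  refine Finset.sum_eq_zero fun i _ => ?_
  change L k i * x i = 0
  by_cases hi : i ∈ A
  · rw [hL.1 k i, zero_mul]
    intro h
    exact hk.2 (Set.mem_biUnion hi h)
  · rw [hx i hi, mul_zero]

theorem logLik_le_of_forall_mul_dotProduct_le {G : MixedGraph V} {S : Matrix V V ℝ}
    (hS : S.IsHermitian) {ε : ℝ} (hε : 0 < ε)
    (h : ∀ C : G.Bi.ConnectedComponent, ∀ y : V → ℝ, (∀ k, k ∉ G.Pa C.supp → y k = 0) →
      ε * (y ⬝ᵥ y) ≤ y ⬝ᵥ (S *ᵥ y)) {A : Matrix V V ℝ} (hA : A ∈ G.PD) :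
    logLik A S ≤ Fintype.card V * (-1 - Real.log ε) := by
  classical
  obtain ⟨L, hL, W, ⟨hW, hWB⟩, rfl⟩ := hA
  set P := 1 - L with hP
  have hPu : IsUnit P := hL.2
  have := Fintype.ofFinite G.Bi.ConnectedComponent
  set A := (P⁻¹)ᵀ * W * P⁻¹ with hA
  have hAinv : A⁻¹ = P * W⁻¹ * Pᵀ := inv_transpose_inv_mul_mul_inv hPu W
  have hK : (A⁻¹).PosDef := by
    rw [hAinv]
    refine hW.inv.mul_mul_conjTranspose_same (B := P) ?_
    exact Matrix.vecMul_injective_of_isUnit hPu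
  have hlog : -Real.log A.det = Real.log (A⁻¹).det := by
    rw [Matrix.det_nonsing_inv, Ring.inverse_eq_inv', Real.log_inv]
  have hblock : ∀ i j, G.Bi.connectedComponentMk i ≠ G.Bi.connectedComponentMk j → W i j = 0 := by
    intro i j hij
    refine hWB i j (fun h => hij (by rw [h])) fun h => hij ?_
    exact SimpleGraph.ConnectedComponent.sound h.reachable
  have htr : 0 ≤ (W⁻¹ * (Pᵀ * (S - ε • 1) * P)).trace := by
    refine trace_mul_nonneg_of_blockwise G.Bi.connectedComponentMk hW.inv.posSemidef
      (fun i j hij => inv_apply_eq_zero_of_blockwise _ hW.isUnit hblock hij) ?_ ?_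
    · refine Matrix.isHermitian_conjTranspose_mul_mul P (hS.sub ?_)
      exact Matrix.isHermitian_one.smul (by simp [IsSelfAdjoint])
    · intro C x hx
      have h1 := h C (P *ᵥ x) fun k hk => mulVec_eq_zero_of_notMem_Pa hL (A := C.supp)
        (fun i hi => hx i hi) hk
      have h2 : x ⬝ᵥ ((Pᵀ * (S - ε • 1) * P) *ᵥ x) =
          (P *ᵥ x) ⬝ᵥ (S *ᵥ (P *ᵥ x)) - ε * ((P *ᵥ x) ⬝ᵥ (P *ᵥ x)) := by
        rw [← Matrix.mulVec_mulVec, ← Matrix.mulVec_mulVec, Matrix.dotProduct_mulVec,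
          Matrix.vecMul_transpose, Matrix.sub_mulVec S, Matrix.smul_mulVec, Matrix.one_mulVec,
          dotProduct_sub, dotProduct_smul, smul_eq_mul]
      rw [h2]
      linarith
  have htr' : (W⁻¹ * (Pᵀ * (S - ε • 1) * P)).trace = (A⁻¹ * S).trace - ε * (A⁻¹).trace := by
    have : W⁻¹ * (Pᵀ * (S - ε • 1) * P) = W⁻¹ * Pᵀ * (S - ε • 1) * P := by
      simp only [Matrix.mul_assoc]
    rw [this, Matrix.trace_mul_comm, hAinv]
    have : P * (W⁻¹ * Pᵀ * (S - ε • 1)) = P * W⁻¹ * Pᵀ * S - ε • (P * W⁻¹ * Pᵀ) := by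
      simp [Matrix.mul_sub, Matrix.mul_assoc]
    rw [this, Matrix.trace_sub, Matrix.trace_smul, smul_eq_mul]
  have hfin := hK.log_det_sub_trace_le hε
  rw [logLik, hlog]
  linarith

theorem supLogLik_lt_top_of_forall {G : MixedGraph V} {S : Matrix V V ℝ} {b : ℝ}
    (h : ∀ A ∈ G.PD, logLik A S ≤ b) : G.supLogLik S < ⊤ :=
  (iSup₂_le fun A hA => EReal.coe_le_coe_iff.2 (h A hA)).trans_lt (EReal.coe_lt_top b)

/-- A vector `v` supported on `Pa(A)` and nonzero on `A` is the image of its restriction `w` to `A`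
under `I - Λ` for some coefficient matrix `Λ`. Only edges from `Pa(A) \ A` into `A` are used, which
makes `Λ² = 0`. -/
theorem exists_mem_coeffMatrices_mulVec_eq (G : MixedGraph V) {A : Set V} {v w : V → ℝ}
    (hv : ∀ k, k ∉ G.Pa A → v k = 0) (hvA : ∀ k ∈ A, v k ≠ 0)
    (hwA : ∀ k ∈ A, w k = v k) (hw : ∀ k, k ∉ A → w k = 0) :
    ∃ L ∈ G.coeffMatrices, (1 - L) *ᵥ w = v := by
  classical
  -- `c k` is a child of `k` in `A`, for `k ∈ Pa(A) \ A`; elsewhere its value is irrelevant.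
  have hc : ∀ k, ∃ c, k ∉ A → k ∈ G.Pa A → c ∈ A ∧ G.Dir k c := by
    intro k
    by_cases hk : k ∉ A ∧ k ∈ G.Pa A
    · rcases hk with ⟨hkA, hk | hk⟩
      · exact absurd hk hkA
      · obtain ⟨c, hcA, hkc⟩ := Set.mem_iUnion₂.1 hk
        exact ⟨c, fun _ _ => ⟨hcA, hkc⟩⟩
    · exact ⟨k, fun h1 h2 => absurd ⟨h1, h2⟩ hk⟩
  choose c hc using hc
  set L : Matrix V V ℝ :=
    Matrix.of fun k j => if k ∉ A ∧ k ∈ G.Pa A ∧ j = c k then -v k / v (c k) else 0 with hL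
  have hLL : L * L = 0 := by
    ext i j
    rw [Matrix.mul_apply]
    refine Finset.sum_eq_zero fun k _ => ?_
    by_cases hk : k ∈ A
    · simp [hL, hk]
    · by_cases hi : i ∉ A ∧ i ∈ G.Pa A ∧ k = c i
      · exact absurd (hi.2.2 ▸ (hc i hi.1 hi.2.1).1) hk
      · simp only [hL, Matrix.of_apply, if_neg hi, zero_mul]
  refine ⟨L, ⟨fun i j hij => ?_, ?_⟩, ?_⟩
  · simp only [hL, Matrix.of_apply]
    rw [if_neg]
    rintro ⟨h1, h2, rfl⟩
    exact hij (hc i h1 h2).2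
  · refine IsUnit.of_mul_eq_one (1 + L) ?_
    rw [Matrix.sub_mul, Matrix.mul_add, Matrix.mul_add, hLL]
    simp
  · ext k
    rw [Matrix.sub_mulVec, Matrix.one_mulVec, Pi.sub_apply]
    by_cases hk : k ∈ A
    · have : (L *ᵥ w) k = 0 := Finset.sum_eq_zero fun j _ => by simp [hL, hk]
      rw [this, hwA k hk, sub_zero]
    · by_cases hkP : k ∈ G.Pa A
      · have : (L *ᵥ w) k = -v k := by
          have hck := (hc k hk hkP).1
          rw [Matrix.mulVec, dotProduct, Finset.sum_eq_single (c k)]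
          · simp [hL, hk, hkP, hwA _ hck, hvA _ hck]
          · intro j _ hj
            simp [hL, hj]
          · simp
        rw [this, hw k hk, zero_sub, neg_neg]
      · have : (L *ᵥ w) k = 0 := Finset.sum_eq_zero fun j _ => by simp [hL, hkP]
        rw [this, hw k hk, hv k hkP, sub_zero]

/-- A vector `w` whose support is a connected component `C` spans the kernel of a positive semidefinite
matrix with the sparsity pattern of the graph. Connectedness of `C` is essential here: the kernel of
the Laplacian consists of the vectors that are constant on components. -/
theorem exists_posSemidef_ker_eq_span (H : SimpleGraph V) (C : H.ConnectedComponent)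
    {w : V → ℝ} (hwC : ∀ k, w k ≠ 0 ↔ k ∈ C.supp) :
    ∃ M : Matrix V V ℝ, M.PosSemidef ∧ (∀ i j, i ≠ j → ¬ H.Adj i j → M i j = 0) ∧
      M *ᵥ w = 0 ∧ ∀ x, M *ᵥ x = 0 → ∃ a : ℝ, x = a • w := by
  classical
  -- The matrix is `D L D + diag d` for the Laplacian `L`; `D w` is the indicator of `C`. As
  -- `0⁻¹ = 0`, the entries of `D` off `C` vanish, and `d` removes these coordinates from the kernel.
  set D : Matrix V V ℝ := Matrix.diagonal fun k => (w k)⁻¹ with hD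
  set d : V → ℝ := fun k => if k ∈ C.supp then 0 else 1 with hd
  have hlap := SimpleGraph.posSemidef_lapMatrix ℝ H
  have hDT : Dᴴ = D := by simp [hD]
  have hM1 : (D * H.lapMatrix ℝ * D).PosSemidef := by
    have := hlap.conjTranspose_mul_mul_same D
    rwa [hDT] at this
  have hd0 : 0 ≤ d := fun k => by simp only [hd, Pi.zero_apply]; split_ifs <;> norm_num
  have hM2 : (Matrix.diagonal d).PosSemidef := Matrix.PosSemidef.diagonal hd0
  have hDx : ∀ x : V → ℝ, D *ᵥ x = fun k => (w k)⁻¹ * x k := fun x => by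
    ext k
    rw [hD, Matrix.mulVec_diagonal]
  refine ⟨D * H.lapMatrix ℝ * D + Matrix.diagonal d, hM1.add hM2, ?_, ?_, ?_⟩
  · intro i j hij hadj
    simp [hD, hij, hadj, SimpleGraph.lapMatrix, SimpleGraph.degMatrix, Matrix.mul_diagonal,
      Matrix.diagonal_mul]
  · have h1 : H.lapMatrix ℝ *ᵥ (D *ᵥ w) = 0 := by
      rw [SimpleGraph.lapMatrix_mulVec_eq_zero_iff_forall_adj, hDx]
      intro i j hij
      change (w i)⁻¹ * w i = (w j)⁻¹ * w j
      have : i ∈ C.supp ↔ j ∈ C.supp := C.mem_supp_congr_adj hij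
      by_cases hi : i ∈ C.supp
      · rw [inv_mul_cancel₀ ((hwC i).2 hi), inv_mul_cancel₀ ((hwC j).2 (this.1 hi))]
      · have hj : j ∉ C.supp := fun h => hi (this.2 h)
        rw [← hwC, not_not] at hi
        rw [← hwC, not_not] at hj
        simp [hi, hj]
    have h2 : Matrix.diagonal d *ᵥ w = 0 := by
      ext k
      rw [Matrix.mulVec_diagonal]
      by_cases hk : k ∈ C.supp
      · simp only [hd, if_pos hk, zero_mul, Pi.zero_apply]
      · have := hk
        rw [← hwC, not_not] at this
        simp [this]
    rw [Matrix.add_mulVec, h2, add_zero, ← Matrix.mulVec_mulVec, ← Matrix.mulVec_mulVec, h1,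
      Matrix.mulVec_zero]
  · intro x hx
    have h0 : x ⬝ᵥ ((D * H.lapMatrix ℝ * D + Matrix.diagonal d) *ᵥ x) = 0 := by
      rw [hx, dotProduct_zero]
    rw [Matrix.add_mulVec, dotProduct_add] at h0
    have n1 := hM1.dotProduct_mulVec_nonneg x
    have n2 := hM2.dotProduct_mulVec_nonneg x
    rw [star_trivial] at n1 n2
    have e1 : x ⬝ᵥ ((D * H.lapMatrix ℝ * D) *ᵥ x) = 0 := by linarith
    have e2 : x ⬝ᵥ (Matrix.diagonal d *ᵥ x) = 0 := by linarith
    have e2' : Matrix.diagonal d *ᵥ x = 0 := by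
      rw [← hM2.dotProduct_mulVec_zero_iff, star_trivial, e2]
    have e1' : H.lapMatrix ℝ *ᵥ (D *ᵥ x) = 0 := by
      rw [← hlap.dotProduct_mulVec_zero_iff, star_trivial, ← e1, ← Matrix.mulVec_mulVec,
        ← Matrix.mulVec_mulVec, Matrix.dotProduct_mulVec x D, ← Matrix.mulVec_transpose]
      simp [hD]
    rw [SimpleGraph.lapMatrix_mulVec_eq_zero_iff_forall_reachable, hDx] at e1'
    obtain ⟨r, hr⟩ := C.nonempty_supp
    refine ⟨(w r)⁻¹ * x r, ?_⟩
    ext k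
    by_cases hk : k ∈ C.supp
    · have hrk : H.Reachable r k := SimpleGraph.ConnectedComponent.exact (hr.trans hk.symm)
      have := e1' r k hrk
      have hwk := (hwC k).2 hk
      simp only at this
      rw [Pi.smul_apply, smul_eq_mul, this]
      field_simp
    · have h1 := congrFun e2' k
      rw [Matrix.mulVec_diagonal] at h1
      have h2 := hk
      rw [← hwC, not_not] at h2
      simpa only [hd, if_neg hk, one_mul, Pi.zero_apply, Pi.smul_apply, h2, smul_zero] using h1

/-- The log-likelihood is unbounded as soon as the data are orthogonal to a vector that is supported on
`Pa(C)` and vanishes nowhere on `C`. It would not be enough for the vector to be nonzero: zeros on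
`C` may disconnect its support there. -/
theorem supLogLik_sampleCov_eq_top (G : MixedGraph V) {n : ℕ} (X : Fin n → V → ℝ)
    (C : G.Bi.ConnectedComponent) {v : V → ℝ} (hv : ∀ k, k ∉ G.Pa C.supp → v k = 0)
    (hvC : ∀ k ∈ C.supp, v k ≠ 0) (hX : ∀ s, X s ⬝ᵥ v = 0) :
    G.supLogLik (sampleCov X) = ⊤ := by
  classical
  set w : V → ℝ := fun k => if k ∈ C.supp then v k else 0 with hw
  obtain ⟨L, hL, hLw⟩ := G.exists_mem_coeffMatrices_mulVec_eq (w := w) hv hvC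
    (fun k hk => by simp only [hw, if_pos hk]) (fun k hk => by simp only [hw, if_neg hk])
  have hwC : ∀ k, w k ≠ 0 ↔ k ∈ C.supp := fun k => by
    by_cases hk : k ∈ C.supp
    · simpa only [hw, if_pos hk, hk, iff_true] using hvC k hk
    · simp only [hw, if_neg hk, hk, ne_eq, not_true]
  obtain ⟨r, hr⟩ := C.nonempty_supp
  have hw0 : w ≠ 0 := fun h => (hwC r).2 hr (congrFun h r)
  obtain ⟨M, hM, hMB, hMw, hker⟩ := exists_posSemidef_ker_eq_span G.Bi C hwC
  set P := 1 - L with hP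
  have hy : ∀ s, w ⬝ᵥ (Pᵀ *ᵥ X s) = 0 := fun s => by
    rw [Matrix.dotProduct_mulVec, Matrix.vecMul_transpose, hLw, dotProduct_comm, hX]
  choose z hz using fun s => exists_mulVec_eq_of_dotProduct_eq_zero hM hw0 hMw hker (hy s)
  set W : ℝ → Matrix V V ℝ := fun t => M + t • 1 with hW
  have hWpos : ∀ t, 0 < t → (W t).PosDef := fun t ht =>
    Matrix.PosDef.posSemidef_add hM (Matrix.PosDef.one.smul ht)
  set A : ℝ → Matrix V V ℝ := fun t => (P⁻¹)ᵀ * W t * P⁻¹ with hA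
  have hAPD : ∀ t, 0 < t → A t ∈ G.PD := fun t ht => by
    refine ⟨L, hL, W t, ⟨hWpos t ht, fun i j hij hadj => ?_⟩, rfl⟩
    simp [hW, hMB i j hij hadj, hij]
  set b := (n : ℝ)⁻¹ * ∑ s, z s ⬝ᵥ (M *ᵥ z s) with hb
  have hlow : ∀ t, 0 < t →
      -Real.log ((P⁻¹).det ^ 2) - b - Real.log (W t).det ≤ logLik (A t) (sampleCov X) := by
    intro t ht
    have h1 : (A t).det = (P⁻¹).det ^ 2 * (W t).det := by
      rw [hA, Matrix.det_mul, Matrix.det_mul, Matrix.det_transpose]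
      ring
    have h2 : ((A t)⁻¹ * sampleCov X).trace ≤ b := by
      rw [hA, inv_transpose_inv_mul_mul_inv hL.2, trace_mul_sampleCov]
      refine mul_le_mul_of_nonneg_left (Finset.sum_le_sum fun s _ => ?_) (by positivity)
      rw [← Matrix.mulVec_mulVec, ← Matrix.mulVec_mulVec, Matrix.dotProduct_mulVec,
        ← Matrix.mulVec_transpose, ← hz s]
      refine dotProduct_inv_mulVec_le hM (hWpos t ht) (fun x => ?_) _
      rw [hW, Matrix.add_mulVec, dotProduct_add, Matrix.smul_mulVec, Matrix.one_mulVec,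
        dotProduct_smul, smul_eq_mul]
      have : 0 ≤ x ⬝ᵥ x := Finset.sum_nonneg fun i _ => mul_self_nonneg _
      nlinarith
    have hPdet : (P⁻¹).det ^ 2 ≠ 0 := by
      have := (Matrix.isUnit_iff_isUnit_det _).1 ((Matrix.isUnit_nonsing_inv_iff).2 hL.2)
      exact pow_ne_zero 2 this.ne_zero
    rw [logLik, h1, Real.log_mul hPdet (hWpos t ht).det_pos.ne']
    linarith
  have hdet : Filter.Tendsto (fun t => (W t).det) (nhdsWithin 0 (Set.Ioi 0))
      (nhdsWithin 0 (Set.Ioi 0)) := by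
    refine tendsto_nhdsWithin_iff.2 ⟨?_, ?_⟩
    · have hc : Continuous fun t => (W t).det :=
        Continuous.matrix_det (continuous_const.add (continuous_id.smul continuous_const))
      have h0 : (W 0).det = 0 := by
        simp only [hW, zero_smul, add_zero]
        exact Matrix.exists_mulVec_eq_zero_iff.1 ⟨w, hw0, hMw⟩
      have := hc.tendsto 0
      rw [h0] at this
      exact this.mono_left nhdsWithin_le_nhds
    · filter_upwards [self_mem_nhdsWithin] with t ht using (hWpos t ht).det_pos
  have hlog := Real.tendsto_log_nhdsGT_zero.comp hdet
  rw [EReal.eq_top_iff_forall_lt]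
  intro y
  obtain ⟨t, hty, ht⟩ := ((hlog.eventually_lt_atBot (-Real.log ((P⁻¹).det ^ 2) - b - y)).and
    self_mem_nhdsWithin).exists
  have h1 := hlow t ht
  simp only [Function.comp_apply] at hty
  refine lt_of_lt_of_le (EReal.coe_lt_coe_iff.2 (lt_of_lt_of_le ?_ h1))
    (le_iSup₂_of_le (A t) (hAPD t ht) le_rfl)
  linarith

end Likelihood

/-! ### Random data -/

section Samples

theorem sum_coe_eq_sum_univ {V : Type*} [Fintype V] {A : Set V} [Fintype A] {g : V → ℝ}
    (hg : ∀ i, i ∉ A → g i = 0) : ∑ i : A, g i = ∑ i, g i := by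
  classical
  rw [Finset.sum_set_coe]
  exact Finset.sum_subset (Finset.subset_univ _) fun i _ hi => hg i (by simpa using hi)

variable {V : Type*} [Fintype V] {P : Measure (V → ℝ)} [IsProbabilityMeasure P]

/-- Fewer than `|A|` data vectors almost surely have an orthogonal vector whose support is exactly `A`.
For a single `k ∈ A`, the data restricted to `A \ {k}` are linearly independent, so the system for an
orthogonal vector with entry `1` at `k` is solvable. A generic vector of the space of solutions
then has no zero on `A`. -/
theorem ae_exists_dotProduct_eq_zero (hP : P ≪ volume) {A : Set V} {n : ℕ} (hn : n < A.ncard) :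
    ∀ᵐ X ∂(Measure.pi fun _ : Fin n => P), ∃ v : V → ℝ, (∀ k, k ∉ A → v k = 0) ∧
      (∀ k ∈ A, v k ≠ 0) ∧ ∀ s, X s ⬝ᵥ v = 0 := by
  classical
  have hk : ∀ k : A, ∀ᵐ X ∂(Measure.pi fun _ : Fin n => P), ∃ v : V → ℝ,
      (∀ i, i ∉ A → v i = 0) ∧ (∀ s, X s ⬝ᵥ v = 0) ∧ v k ≠ 0 := by
    rintro ⟨k, hk⟩
    set B : Set V := A \ {k} with hB
    have hcard : Fintype.card B = A.ncard - 1 := by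
      rw [← Set.ncard_sdiff_singleton_of_mem hk, ← Nat.card_coe_set_eq, Nat.card_eq_fintype_card]
    have hsurj : Function.Surjective (LinearMap.funLeft ℝ ℝ (Subtype.val : B → V)) :=
      LinearMap.funLeft_surjective_of_injective _ _ _ Subtype.val_injective
    filter_upwards [ae_linearIndependent_of_absolutelyContinuous hP hsurj (n := n)
      (by rw [Module.finrank_fintype_fun_eq_card, hcard]; omega)] with X hX
    set T : Matrix (Fin n) B ℝ := Matrix.of fun s i => X s i with hT
    have hTrow : LinearIndependent ℝ T.row := hX
    have hrank := hTrow.rank_matrix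
    have htop : LinearMap.range T.mulVecLin = ⊤ := by
      apply Submodule.eq_top_of_finrank_eq
      rw [Module.finrank_fintype_fun_eq_card]
      exact hrank
    obtain ⟨u, hu⟩ := LinearMap.range_eq_top.1 htop (fun s => -X s k)
    refine ⟨fun i => if h : i ∈ B then u ⟨i, h⟩ else if i = k then 1 else 0, ?_, ?_, ?_⟩
    · intro i hi
      have h1 : i ∉ B := fun h => hi h.1
      have h2 : i ≠ k := by rintro rfl; exact hi hk
      simp [h1, h2]
    · intro s
      have hs := congrFun hu s
      rw [Matrix.mulVecLin_apply, Matrix.mulVec, dotProduct] at hs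
      have h1 : ∀ i, X s i * (if h : i ∈ B then u ⟨i, h⟩ else if i = k then 1 else 0) =
          (if h : i ∈ B then X s i * u ⟨i, h⟩ else 0) + if i = k then X s i else 0 := by
        intro i
        by_cases hi : i ∈ B
        · have : i ≠ k := hi.2
          simp [hi, this]
        · simp [hi]
      rw [dotProduct, Finset.sum_congr rfl fun i _ => h1 i, Finset.sum_add_distrib,
        Finset.sum_ite_eq' , if_pos (Finset.mem_univ k)]
      have h2 : (∑ i, if h : i ∈ B then X s i * u ⟨i, h⟩ else 0) = ∑ i : B, X s i * u i := by
        rw [← sum_coe_eq_sum_univ fun i hi => dif_neg hi]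
        exact Finset.sum_congr rfl fun i _ => dif_pos i.2
      have h3 : (∑ i : B, X s i * u i) = -X s k := hs
      rw [h2, h3, neg_add_cancel]
    · simp [hB]
  filter_upwards [ae_all_iff.2 hk] with X hX
  set p : Submodule ℝ (V → ℝ) :=
    { carrier := {v | (∀ i, i ∉ A → v i = 0) ∧ ∀ s, X s ⬝ᵥ v = 0}
      zero_mem' := by simp
      add_mem' := fun {a b} ha hb =>
        ⟨fun i hi => by simp [ha.1 i hi, hb.1 i hi], fun s => by simp [ha.2 s, hb.2 s]⟩
      smul_mem' := fun c a ha =>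
        ⟨fun i hi => by simp [ha.1 i hi], fun s => by simp [ha.2 s]⟩ } with hp
  obtain ⟨v, hv, hv0⟩ := Module.Dual.exists_forall_mem_ne_zero_of_forall_exists p
    (fun k : A => LinearMap.proj (R := ℝ) (φ := fun _ : V => ℝ) (k : V)) fun k => by
      obtain ⟨v, h1, h2, h3⟩ := hX k
      exact ⟨v, ⟨h1, h2⟩, h3⟩
  exact ⟨v, hv.1, fun k hk => hv0 ⟨k, hk⟩, hv.2⟩

/-- At least `|A|` data vectors almost surely make the sample covariance coercive on the vectors
supported on `A`. -/
theorem ae_exists_pos_mul_dotProduct_le (hP : P ≪ volume) {A : Set V} {n : ℕ}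
    (hn : A.ncard ≤ n) :
    ∀ᵐ X ∂(Measure.pi fun _ : Fin n => P), ∃ ε > (0 : ℝ), ∀ y : V → ℝ, (∀ k, k ∉ A → y k = 0) →
      ε * (y ⬝ᵥ y) ≤ y ⬝ᵥ (sampleCov X *ᵥ y) := by
  classical
  have hsurj : Function.Surjective (LinearMap.funLeft ℝ ℝ (Subtype.val : A → V)) :=
    LinearMap.funLeft_surjective_of_injective _ _ _ Subtype.val_injective
  filter_upwards [ae_span_eq_top_of_absolutelyContinuous hP hsurj (n := n) (by
    rwa [Module.finrank_fintype_fun_eq_card, ← Nat.card_eq_fintype_card,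
      Nat.card_coe_set_eq])] with X hX
  set p : Submodule ℝ (V → ℝ) :=
    { carrier := {y | ∀ i, i ∉ A → y i = 0}
      zero_mem' := by simp
      add_mem' := fun {a b} ha hb i hi => by simp [ha i hi, hb i hi]
      smul_mem' := fun c a ha i hi => by simp [ha i hi] } with hp
  have hsum : ∀ y ∈ p, ∀ x : V → ℝ, x ⬝ᵥ y = ∑ i : A, x i * y i := by
    intro y hy x
    exact (sum_coe_eq_sum_univ fun i hi => by rw [hy i hi, mul_zero]).symm
  obtain ⟨ε, hε, h⟩ := exists_pos_mul_dotProduct_self_le X p fun y hy hXy => by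
    set φ : (A → ℝ) →ₗ[ℝ] ℝ := Fintype.linearCombination ℝ (fun i : A => y i) with hφ
    have hφa : ∀ x : V → ℝ, φ (LinearMap.funLeft ℝ ℝ (Subtype.val : A → V) x) = x ⬝ᵥ y :=
      fun x => by
        rw [hsum y hy]
        simp [hφ, Fintype.linearCombination_apply, LinearMap.funLeft_apply]
    have hφ0 : φ = 0 := by
      refine LinearMap.ext_on_range (v := fun s => LinearMap.funLeft ℝ ℝ Subtype.val (X s)) hX
        fun s => ?_
      rw [hφa, hXy s, LinearMap.zero_apply]
    have := hφa y
    rw [hφ0, LinearMap.zero_apply, eq_comm] at this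
    exact dotProduct_self_eq_zero.1 this
  -- The factor `1 / (n + 1)` instead of `1 / n` keeps the constant positive for `n = 0`.
  refine ⟨((n : ℝ) + 1)⁻¹ * ε, by positivity, fun y hy => ?_⟩
  rw [dotProduct_sampleCov_mulVec, mul_assoc]
  refine (mul_le_mul_of_nonneg_left (h y hy) (by positivity)).trans ?_
  rcases Nat.eq_zero_or_pos n with rfl | hn0
  · simp
  · have : (0 : ℝ) < n := by exact_mod_cast hn0
    refine mul_le_mul_of_nonneg_right ?_ (Finset.sum_nonneg fun s _ => sq_nonneg _)
    gcongr
    linarith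

variable [DecidableEq V]

theorem ae_supLogLik_lt_top (G : MixedGraph V) (hP : P ≪ volume) {n : ℕ}
    (hn : ∀ C : G.Bi.ConnectedComponent, (G.Pa C.supp).ncard ≤ n) :
    ∀ᵐ X ∂(Measure.pi fun _ : Fin n => P), G.supLogLik (sampleCov X) < ⊤ := by
  filter_upwards [ae_all_iff.2 fun C => ae_exists_pos_mul_dotProduct_le hP (hn C)] with X hX
  choose ε hε h using hX
  have hev : ∀ᶠ δ in nhdsWithin (0 : ℝ) (Set.Ioi 0), ∀ C, δ ≤ ε C :=
    Filter.eventually_all.2 fun C =>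
      nhdsWithin_le_nhds ((eventually_lt_nhds (hε C)).mono fun _ h => h.le)
  obtain ⟨δ, hδε, hδ⟩ := (hev.and self_mem_nhdsWithin).exists
  refine supLogLik_lt_top_of_forall fun A hA =>
    logLik_le_of_forall_mul_dotProduct_le (isHermitian_sampleCov X) hδ (fun C y hy => ?_) hA
  refine le_trans ?_ (h C y hy)
  exact mul_le_mul_of_nonneg_right (hδε C) (Finset.sum_nonneg fun i _ => mul_self_nonneg _)

theorem ae_supLogLik_eq_top (G : MixedGraph V) (hP : P ≪ volume) {n : ℕ}
    {C : G.Bi.ConnectedComponent} (hn : n < (G.Pa C.supp).ncard) :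
    ∀ᵐ X ∂(Measure.pi fun _ : Fin n => P), G.supLogLik (sampleCov X) = ⊤ := by
  filter_upwards [ae_exists_dotProduct_eq_zero hP hn] with X ⟨v, hv, hv0, hXv⟩
  exact G.supLogLik_sampleCov_eq_top X C hv (fun k hk => hv0 k (Or.inl hk)) hXv

end Samples

end MixedGraph

/-! ### The threshold -/

theorem theorem1p2 {V : Type*} [Fintype V] [DecidableEq V] (G : MixedGraph V)
    (P : Measure (V → ℝ)) [IsProbabilityMeasure P] (hP : P ≪ volume) :
    (G.boundedSampleSizes P).Nonempty ∧
    G.mlThreshold P = (⨆ C : G.Bi.ConnectedComponent, (G.Pa C.supp).ncard) ∧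
    ∀ n < G.mlThreshold P,
      ∀ᵐ X ∂(Measure.pi fun _ : Fin n => P), G.supLogLik (MixedGraph.sampleCov X) = ⊤ := by
  set N := ⨆ C : G.Bi.ConnectedComponent, (G.Pa C.supp).ncard with hN
  have hmem : N ∈ G.boundedSampleSizes P := fun n hn =>
    G.ae_supLogLik_lt_top hP fun C => (le_ciSup (Set.finite_range _).bddAbove C).trans hn
  have htop : ∀ n < N, ∀ᵐ X ∂(Measure.pi fun _ : Fin n => P),
      G.supLogLik (MixedGraph.sampleCov X) = ⊤ := by
    intro n hn
    rcases isEmpty_or_nonempty G.Bi.ConnectedComponent with h | h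
    · simp [hN] at hn
    · obtain ⟨C, hC⟩ := exists_lt_of_lt_ciSup hn
      exact G.ae_supLogLik_eq_top hP hC
  have hthr : G.mlThreshold P = N := by
    refine le_antisymm (Nat.sInf_le hmem) (le_csInf ⟨N, hmem⟩ fun m hm => ?_)
    by_contra! hlt
    obtain ⟨X, h1, h2⟩ := ((htop m hlt).and (hm m le_rfl)).exists
    exact h2.ne h1
  exact ⟨⟨N, hmem⟩, hthr, fun n hn => htop n (hthr ▸ hn)⟩
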